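/- Let $k$ be an algebraically closed field of characteristic $\chi$ (zero or a prime), let $m,n\in\mathbb{N}$, and let $f_1,\dots,f_m\in k[t_1,\dots,t_n]$ be algebraically independent over $k$. A polynomial $g\in k[t_1,\dots,t_n]$ is called determined by $f=(f_1,\dots,f_m)$ if for all $a,b\in k^n$ with $f_i(a)=f_i(b)$ for $i=1,\dots,m$ one has $g(a)=g(b)$. Let $k\langle f_1,\dots,f_m\rangle$ denote the $k$-subalgebra of $k[t_1,\dots,t_n]$ consisting of all polynomials determined by $f$, and let $k(f_1,\dots,f_m)$ denote the subfield of the quotient field $k(t_1,\dots,t_n)$ of $k[t_1,\dots,t_n]$ generated by $k\cup\{f_1,\dots,f_m\}$. For $\chi>0$ and $P\subseteq k[t_1,\dots,t_n]$ put $$\operatorname{rad}_\chi(P)=\{g\in k[t_1,\dots,t_n] : g^{\chi^\nu}\in P\text{ for some integer }\nu\ge 0\}.$$ Then: 1. If $\chi=0$, then $k\langle f_1,\dots,f_m\rangle\subseteq k(f_1,\dots,f_m)\cap k[t_1,\dots,t_n]$. 2. If $\chi>0$, then $k\langle f_1,\dots,f_m\rangle\subseteq \operatorname{rad}_\chi\bigl(k(f_1,\dots,f_m)\cap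 k[t_1,\dots,t_n]\bigr)$. -/

import Mathlib

namespace DeterminedPoly

variable {k : Type*} [Field k] {m n : ℕ}

/-- The polynomial `g` is determined by `f = (f₁, …, f_m)`: for all points `a, b` of `k ^ n`
with `f_i(a) = f_i(b)` for every `i`, one has `g(a) = g(b)`. -/
def IsDeterminedBy (f : Fin m → MvPolynomial (Fin n) k) (g : MvPolynomial (Fin n) k) : Prop :=
  ∀ a b : Fin n → k,
    (∀ i, MvPolynomial.eval a (f i) = MvPolynomial.eval b (f i)) →
      MvPolynomial.eval a g = MvPolynomial.eval b g

/-- `k⟨f₁, …, f_m⟩`: the `k`-subalgebra of `k[t₁, …, t_n]` of all polynomials that are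
determined by `f`. -/
def determined (f : Fin m → MvPolynomial (Fin n) k) :
    Subalgebra k (MvPolynomial (Fin n) k) where
  carrier := {g | IsDeterminedBy f g}
  mul_mem' := by
    intro p q hp hq a b hab
    rw [map_mul, map_mul, hp a b hab, hq a b hab]
  add_mem' := by
    intro p q hp hq a b hab
    rw [map_add, map_add, hp a b hab, hq a b hab]
  algebraMap_mem' := by
    intro r a b _
    simp [MvPolynomial.algebraMap_eq]

/-- `k(f₁, …, f_m)`: the subfield of the field of fractions `k(t₁, …, t_n)` of
`k[t₁, …, t_n]` that is generated by `k` and `f₁, …, f_m`. -/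
noncomputable def rationalField (f : Fin m → MvPolynomial (Fin n) k) :
    IntermediateField k (FractionRing (MvPolynomial (Fin n) k)) :=
  IntermediateField.adjoin k
    (Set.range fun i =>
      algebraMap (MvPolynomial (Fin n) k) (FractionRing (MvPolynomial (Fin n) k)) (f i))

/-- `k(f₁, …, f_m) ∩ k[t₁, …, t_n]`, as a set of polynomials. -/
def rationalPolynomials (f : Fin m → MvPolynomial (Fin n) k) :
    Set (MvPolynomial (Fin n) k) :=
  {g | algebraMap (MvPolynomial (Fin n) k) (FractionRing (MvPolynomial (Fin n) k)) g ∈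
    rationalField f}

/-- `rad_χ(P)`: the polynomials `g` such that `g ^ (χ ^ ν) ∈ P` for some `ν ≥ 0`. -/
def radChar (χ : ℕ) (P : Set (MvPolynomial (Fin n) k)) : Set (MvPolynomial (Fin n) k) :=
  {g | ∃ ν : ℕ, g ^ (χ ^ ν) ∈ P}

end DeterminedPoly

/-! Let `K = k(t)`, `L = k(f)`. If `g` is determined by `f`, then `g ⊗ 1 - 1 ⊗ g` vanishes at every
pair `(a, b)` with `f(a) = f(b)`, so by the Nullstellensatz a power of it lies in the ideal of the
`f i ⊗ 1 - 1 ⊗ f i`. These die in `K ⊗[L] K`, where `g ⊗ 1 - 1 ⊗ g` is therefore nilpotent. In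
characteristic zero separability makes it zero; in characteristic `p` a power of Frobenius kills it.
Elements with `x ⊗ 1 = 1 ⊗ x` lie in `L`. -/

namespace DeterminedPoly

open scoped TensorProduct

section FieldExtension

variable {L K : Type*} [Field L] [Field K] [Algebra L K]

/-- In `K ⊗[L] K`, the two copies of `K` meet only in `L`. -/
theorem mem_range_algebraMap_of_tmul_one_eq_one_tmul {x : K}
    (h : x ⊗ₜ[L] (1 : K) = (1 : K) ⊗ₜ[L] x) : x ∈ (algebraMap L K).range := by
  by_contra hx
  have hx' : x ∉ Submodule.span L {(1 : K)} := by
    rw [Submodule.mem_span_singleton]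
    rintro ⟨c, hc⟩
    exact hx ⟨c, by rw [← hc, Algebra.smul_def, mul_one]⟩
  obtain ⟨φ, hφx, hφ⟩ := Submodule.exists_le_ker_of_notMem hx'
  have hφ1 : φ 1 = 0 := hφ (Submodule.mem_span_singleton_self 1)
  -- Contracting the left factor with `φ` turns `h` into `φ x = φ 1 • x = 0`.
  have := congrArg (fun z => TensorProduct.lid L K (φ.rTensor K z)) h
  simp [hφ1] at this
  exact hφx this

theorem isAlgebraic_of_isNilpotent_tmul_sub_tmul {x : K}
    (h : IsNilpotent (x ⊗ₜ[L] (1 : K) - (1 : K) ⊗ₜ[L] x)) : IsAlgebraic L x := by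
  by_contra hx
  have hinj : Function.Injective (Polynomial.aeval (R := L) x) :=
    transcendental_iff_injective.mp hx
  have hmap : Function.Injective
      (Algebra.TensorProduct.map (Polynomial.aeval (R := L) x) (Polynomial.aeval (R := L) x)) :=
    TensorProduct.map_injective_of_flat_flat _ _ hinj hinj
  have hX : IsNilpotent ((Polynomial.X : Polynomial L) ⊗ₜ[L] (1 : Polynomial L) -
      (1 : Polynomial L) ⊗ₜ[L] (Polynomial.X : Polynomial L)) := by
    rw [← IsNilpotent.map_iff hmap]
    simpa using h
  -- Setting the second variable to `0` would make `X` nilpotent in `L[X]`.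
  have hX' := hX.map (Algebra.TensorProduct.lift (AlgHom.id L (Polynomial L))
    (Polynomial.aeval (R := L) (0 : Polynomial L)) fun _ _ => Commute.all _ _)
  simp at hX'

/-- The extension `L(x)/L` is finite separable, so its tensor square is reduced; by flatness that
square embeds in `K ⊗[L] K`. -/
theorem mem_range_algebraMap_of_isNilpotent_tmul_sub_tmul [CharZero L] {x : K}
    (h : IsNilpotent (x ⊗ₜ[L] (1 : K) - (1 : K) ⊗ₜ[L] x)) : x ∈ (algebraMap L K).range := by
  have hint : IsIntegral L x := (isAlgebraic_of_isNilpotent_tmul_sub_tmul h).isIntegral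
  have : FiniteDimensional L (IntermediateField.adjoin L {x}) :=
    IntermediateField.adjoin.finiteDimensional hint
  have : Algebra.FormallyUnramified L (IntermediateField.adjoin L {x}) :=
    Algebra.FormallyUnramified.of_isSeparable _ _
  have hred : IsReduced
      ((IntermediateField.adjoin L {x}) ⊗[L] (IntermediateField.adjoin L {x})) :=
    Algebra.FormallyUnramified.isReduced_of_field (IntermediateField.adjoin L {x})
      ((IntermediateField.adjoin L {x}) ⊗[L] (IntermediateField.adjoin L {x}))
  set y : IntermediateField.adjoin L {x} := IntermediateField.AdjoinSimple.gen L x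
  have hinj : Function.Injective (IntermediateField.adjoin L {x}).val :=
    (IntermediateField.adjoin L {x}).val.injective
  have hmap : Function.Injective (Algebra.TensorProduct.map
      (IntermediateField.adjoin L {x}).val (IntermediateField.adjoin L {x}).val) :=
    TensorProduct.map_injective_of_flat_flat _ _ hinj hinj
  have hy : IsNilpotent (y ⊗ₜ[L] (1 : IntermediateField.adjoin L {x}) -
      (1 : IntermediateField.adjoin L {x}) ⊗ₜ[L] y) := by
    rw [← IsNilpotent.map_iff hmap]
    simpa [y] using h
  obtain ⟨c, hc⟩ := mem_range_algebraMap_of_tmul_one_eq_one_tmul (sub_eq_zero.mp hy.eq_zero)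
  exact ⟨c, congrArg (IntermediateField.adjoin L {x}).val hc⟩

theorem exists_pow_mem_range_algebraMap_of_isNilpotent_tmul_sub_tmul (p : ℕ) [Fact p.Prime]
    [CharP L p] {x : K} (h : IsNilpotent (x ⊗ₜ[L] (1 : K) - (1 : K) ⊗ₜ[L] x)) :
    ∃ ν : ℕ, x ^ p ^ ν ∈ (algebraMap L K).range := by
  obtain ⟨N, hN⟩ := h
  have : CharP (K ⊗[L] K) p :=
    charP_of_injective_algebraMap (algebraMap L (K ⊗[L] K)).injective p
  -- Since `N < p ^ N`, the nilpotency exponent itself serves as `ν`.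
  have hpow := pow_eq_zero_of_le (Nat.lt_pow_self (Fact.out : p.Prime).one_lt).le hN
  refine ⟨N, mem_range_algebraMap_of_tmul_one_eq_one_tmul ?_⟩
  rw [sub_pow_char_pow, Algebra.TensorProduct.tmul_pow, Algebra.TensorProduct.tmul_pow,
    one_pow, sub_eq_zero] at hpow
  exact hpow

end FieldExtension

/-- Nullstellensatz over an algebraically closed field `k`: an element of a finitely generated
`k`-algebra that vanishes at all `k`-points of an ideal lies in the radical of the ideal. -/
theorem mem_radical_of_forall_algHom {k B : Type*} [Field k] [IsAlgClosed k] [CommRing B]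
    [Algebra k B] [Algebra.FiniteType k B] {I : Ideal B} {x : B}
    (h : ∀ φ : B →ₐ[k] k, (∀ y ∈ I, φ y = 0) → φ x = 0) : x ∈ I.radical := by
  have : IsJacobsonRing B := isJacobsonRing_of_finiteType (A := k)
  rw [I.radical_eq_jacobson, Ideal.jacobson, Ideal.mem_sInf]
  rintro M ⟨hIM, hM⟩
  let := Ideal.Quotient.field M
  -- Zariski's lemma: each residue field is `k`, so maximal ideals are `k`-points.
  have : Module.Finite k (B ⧸ M) := finite_of_finite_type_of_isJacobsonRing k (B ⧸ M)
  let e : k ≃ₐ[k] B ⧸ M := AlgEquiv.ofBijective (Algebra.ofId k (B ⧸ M))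
    IsAlgClosed.algebraMap_bijective_of_isIntegral
  have hx := h (e.symm.toAlgHom.comp (Ideal.Quotient.mkₐ k M)) fun y hy => by
    simpa using Ideal.Quotient.eq_zero_iff_mem.mpr (hIM hy)
  exact Ideal.Quotient.eq_zero_iff_mem.mp (by simpa using hx)

variable {k : Type*} [Field k] {m n : ℕ}

/-- The `k`-points of the tensor square are the pairs `(a, b)`; those killing the ideal are the
pairs on which `f` agrees. -/
theorem IsDeterminedBy.tmul_sub_tmul_mem_radical [IsAlgClosed k]
    {f : Fin m → MvPolynomial (Fin n) k} {g : MvPolynomial (Fin n) k} (hg : IsDeterminedBy f g) :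
    g ⊗ₜ[k] (1 : MvPolynomial (Fin n) k) - (1 : MvPolynomial (Fin n) k) ⊗ₜ[k] g ∈
      (Ideal.span (Set.range fun i => f i ⊗ₜ[k] (1 : MvPolynomial (Fin n) k) -
        (1 : MvPolynomial (Fin n) k) ⊗ₜ[k] f i)).radical := by
  have : Algebra.FiniteType k (MvPolynomial (Fin n) k ⊗[k] MvPolynomial (Fin n) k) :=
    .trans (S := MvPolynomial (Fin n) k) inferInstance inferInstance
  refine mem_radical_of_forall_algHom (k := k) fun φ hφ => ?_
  set a : Fin n → k := fun j => φ (MvPolynomial.X j ⊗ₜ 1)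
  set b : Fin n → k := fun j => φ (1 ⊗ₜ MvPolynomial.X j)
  have ha (p : MvPolynomial (Fin n) k) : φ (p ⊗ₜ 1) = MvPolynomial.eval a p :=
    DFunLike.congr_fun (MvPolynomial.algHom_ext (f := φ.comp Algebra.TensorProduct.includeLeft)
      (g := MvPolynomial.aeval a) fun j => by simp [a]) p
  have hb (p : MvPolynomial (Fin n) k) : φ (1 ⊗ₜ p) = MvPolynomial.eval b p :=
    DFunLike.congr_fun (MvPolynomial.algHom_ext (f := φ.comp Algebra.TensorProduct.includeRight)
      (g := MvPolynomial.aeval b) fun j => by simp [b]) p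
  rw [map_sub, ha, hb, sub_eq_zero]
  refine hg a b fun i => ?_
  rw [← ha, ← hb, ← sub_eq_zero, ← map_sub]
  exact hφ _ (Ideal.subset_span ⟨i, rfl⟩)

theorem IsDeterminedBy.isNilpotent_tmul_sub_tmul [IsAlgClosed k] {L K : Type*} [Field L] [Field K]
    [Algebra k L] [Algebra L K] [Algebra k K] [IsScalarTower k L K]
    {f : Fin m → MvPolynomial (Fin n) k} {g : MvPolynomial (Fin n) k} (hg : IsDeterminedBy f g)
    (ι : MvPolynomial (Fin n) k →ₐ[k] K) (hι : ∀ i, ι (f i) ∈ (algebraMap L K).range) :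
    IsNilpotent (ι g ⊗ₜ[L] (1 : K) - (1 : K) ⊗ₜ[L] ι g) := by
  obtain ⟨N, hN⟩ := hg.tmul_sub_tmul_mem_radical
  let ψ : MvPolynomial (Fin n) k ⊗[k] MvPolynomial (Fin n) k →ₐ[k] K ⊗[L] K :=
    Algebra.TensorProduct.lift
      ((Algebra.TensorProduct.includeLeft (R := L) (S := k) (A := K) (B := K)).comp ι)
      (((Algebra.TensorProduct.includeRight (R := L) (A := K)
        (B := K)).restrictScalars k).comp ι) fun _ _ => Commute.all _ _
  have hψ (p : MvPolynomial (Fin n) k) :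
      ψ (p ⊗ₜ 1 - 1 ⊗ₜ p) = ι p ⊗ₜ[L] 1 - 1 ⊗ₜ[L] ι p := by
    simp [ψ]
  have hker : Ideal.span (Set.range fun i => f i ⊗ₜ[k] (1 : MvPolynomial (Fin n) k) -
      (1 : MvPolynomial (Fin n) k) ⊗ₜ[k] f i) ≤ RingHom.ker ψ := by
    rw [Ideal.span_le]
    rintro _ ⟨i, rfl⟩
    obtain ⟨c, hc⟩ := hι i
    change ψ _ = 0
    rw [hψ, sub_eq_zero, ← hc]
    exact Algebra.TensorProduct.tmul_one_eq_one_tmul c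
  refine ⟨N, ?_⟩
  rw [← hψ, ← map_pow]
  exact hker hN

/-- The inclusion of `k[t₁, …, t_n]` in `k(t₁, …, t_n)`. -/
noncomputable def toRationalFunctions (k : Type*) [Field k] (n : ℕ) :
    MvPolynomial (Fin n) k →ₐ[k] FractionRing (MvPolynomial (Fin n) k) :=
  IsScalarTower.toAlgHom k _ _

theorem toRationalFunctions_mem_range (f : Fin m → MvPolynomial (Fin n) k) (i : Fin m) :
    toRationalFunctions k n (f i) ∈
      (algebraMap (rationalField f) (FractionRing (MvPolynomial (Fin n) k))).range :=
  ⟨⟨_, IntermediateField.subset_adjoin k _ ⟨i, rfl⟩⟩, rfl⟩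

theorem mem_rationalPolynomials_of_mem_range {f : Fin m → MvPolynomial (Fin n) k}
    {g : MvPolynomial (Fin n) k}
    (h : toRationalFunctions k n g ∈
      (algebraMap (rationalField f) (FractionRing (MvPolynomial (Fin n) k))).range) :
    g ∈ rationalPolynomials f := by
  obtain ⟨c, hc⟩ := h
  have hc' : (c : FractionRing (MvPolynomial (Fin n) k)) = algebraMap _ _ g := hc
  change algebraMap _ _ g ∈ rationalField f
  rw [← hc']
  exact c.2

end DeterminedPoly

theorem mainTheorem3 {k : Type*} [Field k] [IsAlgClosed k] (χ : ℕ) [CharP k χ] (m n : ℕ)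
    (f : Fin m → MvPolynomial (Fin n) k) (hf : AlgebraicIndependent k f) :
    (χ = 0 →
      (DeterminedPoly.determined f : Set (MvPolynomial (Fin n) k)) ⊆
        DeterminedPoly.rationalPolynomials f) ∧
    (0 < χ →
      (DeterminedPoly.determined f : Set (MvPolynomial (Fin n) k)) ⊆
        DeterminedPoly.radChar χ (DeterminedPoly.rationalPolynomials f)) := by
  have hL : CharP (DeterminedPoly.rationalField f) χ :=
    charP_of_injective_algebraMap (algebraMap k (DeterminedPoly.rationalField f)).injective χ
  have hnil (g : MvPolynomial (Fin n) k) (hg : DeterminedPoly.IsDeterminedBy f g) :=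
    hg.isNilpotent_tmul_sub_tmul (L := DeterminedPoly.rationalField f)
      (DeterminedPoly.toRationalFunctions k n) (DeterminedPoly.toRationalFunctions_mem_range f)
  refine ⟨fun hχ g hg => ?_, fun hχ g hg => ?_⟩
  · subst hχ
    have : CharZero (DeterminedPoly.rationalField f) := CharP.charP_to_charZero _
    exact DeterminedPoly.mem_rationalPolynomials_of_mem_range
      (DeterminedPoly.mem_range_algebraMap_of_isNilpotent_tmul_sub_tmul (hnil g hg))
  · have : Fact χ.Prime := ⟨(CharP.char_is_prime_or_zero k χ).resolve_right hχ.ne'⟩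
    obtain ⟨ν, hν⟩ :=
      DeterminedPoly.exists_pow_mem_range_algebraMap_of_isNilpotent_tmul_sub_tmul χ (hnil g hg)
    rw [← map_pow] at hν
    exact ⟨ν, DeterminedPoly.mem_rationalPolynomials_of_mem_range hν⟩
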